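/- Let $d\ge 1$, let $\mathbb B_d$ be the open unit ball of $\mathbb C^d$, and let $\mathcal H$ be the reproducing kernel Hilbert space on $\mathbb B_d$ with kernel $k$. Assume: 1. (unitarily invariant) $k(0,w)=1$ for all $w\in\mathbb B_d$; $k$ is analytic in the first variable and co-analytic in the second; and $k(Uz,Uw)=k(z,w)$ for all $z,w\in\mathbb B_d$ and every unitary $U$ on $\mathbb C^d$; 2. (regular) $k(z,w)=\sum_{n\ge 0}a_n\langle z,w\rangle^n$ with $a_n>0$ for all $n$ and $\lim_{n}a_n/a_{n+1}=1$; 3. (complete Nevanlinna--Pick) $1-\dfrac1{k(z,w)}=\sum_{n\ge1}b_n\langle z,w\rangle^n$ on $\mathbb B_d\times\mathbb B_d$ for some numbers $b_n\ge0$ (then automatically $\sum_{n\ge1} b_n\le1$); 4. (not maximal) $\sum_{n\ge1}b_n\neq1$, i.e. $\sum_{n\ge 1}b_n<1$. Let $\mathcal M(\mathcal H)\subset B(\mathcal H)$ be the multiplier algebra, acting by multiplication operators $M_\psi$, and let $\mathcal A(\mathcal H)\subset \mathcal M(\mathcal H)$ be the norm closure of the polynomials. Let $\mathfrak a$ be a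 proper weak-$*$ closed ideal of $\mathcal M(\mathcal H)$, put $$\mathcal H_{\mathfrak a}=\mathcal H\ominus\overline{\operatorname{span}}\{M_\phi f:\phi\in\mathfrak a,\ f\in\mathcal H\},$$ and let $\mathcal A_{\mathfrak a}\subset B(\mathcal H_{\mathfrak a})$ be the norm closure of $\{P_{\mathcal H_{\mathfrak a}}M_\phi|_{\mathcal H_{\mathfrak a}}:\phi\in\mathcal A(\mathcal H)\}$. Assume $\dim\mathcal H_{\mathfrak a}>1$. Then the Gelfand transform $g:\mathcal A_{\mathfrak a}\to C(\Delta(\mathcal A_{\mathfrak a}))$, $g(b)(\chi)=\chi(b)$, where $\Delta(\mathcal A_{\mathfrak a})$ is the space of characters of $\mathcal A_{\mathfrak a}$, is not completely isometric; that is, it is not the case that for every $n\ge1$ and every matrix $[b_{ij}]\in M_n(\mathcal A_{\mathfrak a})$ one has $$\sup_{\chi\in\Delta(\mathcal A_{\mathfrak a})}\bigl\|[\chi(b_{ij})]\bigr\|_{M_n(\mathbb C)}=\bigl\|[b_{ij}]\bigr\|_{B(\mathcal H_{\mathfrak a}^{(n)})}.$$ -/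

import Mathlib

open Filter Topology ComplexConjugate

noncomputable section

namespace NPSpace

/-! ### Unitarily invariant kernels on the unit ball -/

/-- The open unit ball `𝔹_d` of `ℂ^d`, with the Euclidean norm. -/
abbrev UnitBall (d : ℕ) : Type :=
  Metric.ball (0 : EuclideanSpace ℂ (Fin d)) 1

/-- The inner product `⟨z, w⟩ = ∑ j, z_j * conj w_j`, linear in `z`. -/
def cinner {d : ℕ} (z w : UnitBall d) : ℂ :=
  inner ℂ (w : EuclideanSpace ℂ (Fin d)) (z : EuclideanSpace ℂ (Fin d))

/-- The image of a point of the ball under a unitary operator of `ℂ^d`. -/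
def unitaryImage {d : ℕ}
    (U : EuclideanSpace ℂ (Fin d) ≃ₗᵢ[ℂ] EuclideanSpace ℂ (Fin d)) (z : UnitBall d) :
    UnitBall d :=
  ⟨U z, by
    have hz := z.2
    rw [mem_ball_zero_iff] at hz ⊢
    rwa [U.norm_map]⟩

/-- Normalization at the origin, analyticity in the first variable, co-analyticity in the second
variable, and invariance under the unitary group. (Positive semidefiniteness is automatic for the
reproducing kernels to which this is applied.) -/
structure IsUnitarilyInvariant {d : ℕ} (k : UnitBall d → UnitBall d → ℂ) : Prop where
  normalized : ∀ z w : UnitBall d, (z : EuclideanSpace ℂ (Fin d)) = 0 → k z w = 1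
  analytic_left : ∀ w : UnitBall d, ∃ F : EuclideanSpace ℂ (Fin d) → ℂ,
    AnalyticOnNhd ℂ F (Metric.ball 0 1) ∧ ∀ z : UnitBall d, F z = k z w
  coanalytic_right : ∀ z : UnitBall d, ∃ F : EuclideanSpace ℂ (Fin d) → ℂ,
    AnalyticOnNhd ℂ F (Metric.ball 0 1) ∧ ∀ w : UnitBall d, F w = conj (k z w)
  unitary_invariant : ∀ (U : EuclideanSpace ℂ (Fin d) ≃ₗᵢ[ℂ] EuclideanSpace ℂ (Fin d))
    (z w : UnitBall d), k (unitaryImage U z) (unitaryImage U w) = k z w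

/-- A unitarily invariant kernel is regular if `k(z,w) = ∑ n, a_n ⟨z,w⟩^n` where `a_n > 0` for
every `n` and `a_n / a_{n+1} → 1`. -/
structure IsRegularUnitarilyInvariant {d : ℕ} (k : UnitBall d → UnitBall d → ℂ) : Prop
    extends IsUnitarilyInvariant k where
  exists_coeff : ∃ a : ℕ → ℝ, (∀ n, 0 < a n) ∧
    Tendsto (fun n => a n / a (n + 1)) atTop (𝓝 1) ∧
    ∀ z w : UnitBall d, HasSum (fun n => (a n : ℂ) * cinner z w ^ n) (k z w)

/-- The numbers `b_1, b_2, …` are non-negative, and `1 - 1/k(z,w) = ∑_{n ≥ 1} b_n ⟨z,w⟩^n`.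
(The value `b 0` plays no role.) -/
structure IsNPCoeff {d : ℕ} (k : UnitBall d → UnitBall d → ℂ) (b : ℕ → ℝ) : Prop where
  nonneg : ∀ n, 0 ≤ b (n + 1)
  ne_zero : ∀ z w : UnitBall d, k z w ≠ 0
  hasSum : ∀ z w : UnitBall d,
    HasSum (fun n => (b (n + 1) : ℂ) * cinner z w ^ (n + 1)) (1 - 1 / k z w)

/-- The complete Nevanlinna–Pick property of a (unitarily invariant) kernel. -/
def IsCompleteNevanlinnaPick {d : ℕ} (k : UnitBall d → UnitBall d → ℂ) : Prop :=
  ∃ b : ℕ → ℝ, IsNPCoeff k b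

/-- A complete Nevanlinna–Pick kernel is maximal if `∑_{n ≥ 1} b_n = 1`. -/
def IsMaximalKernel {d : ℕ} (k : UnitBall d → UnitBall d → ℂ) : Prop :=
  ∃ b : ℕ → ℝ, IsNPCoeff k b ∧ HasSum (fun n => b (n + 1)) 1

/-! ### Multipliers -/

section Multipliers

variable {X : Type*} (H : Type*) [NormedAddCommGroup H] [InnerProductSpace ℂ H]
  [CompleteSpace H] [RKHS ℂ H X ℂ]

/-- The scalar reproducing kernel `k(z,w) = k_w(z)` of a reproducing kernel Hilbert space of
complex valued functions, so that `⟨f, k_w⟩ = f(w)`. -/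
def reproducingKernel (z w : X) : ℂ := RKHS.kernel H z w 1

/-- `T` is the operator `M_ψ` of multiplication by `ψ`. -/
def IsMulOperator {H : Type*} [NormedAddCommGroup H] [InnerProductSpace ℂ H]
    [RKHS ℂ H X ℂ] (ψ : X → ℂ) (T : H →L[ℂ] H) : Prop :=
  ∀ (f : H) (z : X), T f z = ψ z * f z

/-- If `ψ f ∈ H` for every `f ∈ H`, then multiplication by `ψ` is a bounded operator. Hence
bounded multiplication operators and multipliers are the same thing. -/
theorem exists_isMulOperator (ψ : X → ℂ)
    (hψ : ∀ f : H, ∃ g : H, ∀ z, g z = ψ z * f z) : ∃ T : H →L[ℂ] H, IsMulOperator ψ T := by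
  choose g hg using hψ
  let L : H →ₗ[ℂ] H :=
    { toFun := g
      map_add' := fun f₁ f₂ => RKHS.ext fun z => by
        simp [hg, mul_add]
      map_smul' := fun c f => RKHS.ext fun z => by
        simp [hg]; ring }
  have hL : Continuous L := by
    refine L.continuous_of_seq_closed_graph fun u x y hu hLu => RKHS.ext fun z => ?_
    have h1 : Tendsto (fun n => (L (u n)) z) atTop (𝓝 (y z)) :=
      ((RKHS.continuous_eval z).tendsto y).comp hLu
    have h2 : Tendsto (fun n => ψ z * (u n) z) atTop (𝓝 (ψ z * x z)) :=
      (((RKHS.continuous_eval z).tendsto x).comp hu).const_mul _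
    have h3 : (fun n => (L (u n)) z) = fun n => ψ z * (u n) z := funext fun n => hg (u n) z
    rw [h3] at h1
    rw [tendsto_nhds_unique h1 h2]
    exact (hg x z).symm
  exact ⟨⟨L, hL⟩, fun f z => hg f z⟩

/-- The multiplier algebra `𝓜(H)`, viewed as an algebra of bounded operators on `H`. -/
def multiplierAlgebra : Subalgebra ℂ (H →L[ℂ] H) where
  carrier := {T | ∃ ψ : X → ℂ, IsMulOperator ψ T}
  mul_mem' := by
    rintro S T ⟨φ, hφ⟩ ⟨ψ, hψ⟩
    refine ⟨φ * ψ, fun f z => ?_⟩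
    change S (T f) z = _
    rw [hφ, hψ, Pi.mul_apply, mul_assoc]
  add_mem' := by
    rintro S T ⟨φ, hφ⟩ ⟨ψ, hψ⟩
    refine ⟨φ + ψ, fun f z => ?_⟩
    change (S f + T f) z = _
    rw [RKHS.coe_add, Pi.add_apply, hφ, hψ, Pi.add_apply, add_mul]
  algebraMap_mem' := fun c => ⟨fun _ => c, fun f z => by
    change (c • f) z = _
    simp⟩

/-- Multiplication operators commute, so one-sided ideals of `𝓜(H)` are two-sided. -/
theorem multiplierAlgebra_mul_comm (S T : multiplierAlgebra H) : S * T = T * S := by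
  obtain ⟨S, φ, hφ⟩ := S
  obtain ⟨T, ψ, hψ⟩ := T
  refine Subtype.ext (ContinuousLinearMap.ext fun f => RKHS.ext fun z => ?_)
  change S (T f) z = T (S f) z
  rw [hφ, hψ, hψ, hφ, mul_left_comm]

/-- The weak-* (ultraweak) topology of `B(H)`, the dual space of the trace class operators: the
coarsest topology for which the functionals `T ↦ ∑ n, ⟨T x_n, y_n⟩` are continuous, for all square
summable sequences `(x_n)` and `(y_n)` in `H`. -/
def weakStarTopology (H : Type*) [NormedAddCommGroup H] [InnerProductSpace ℂ H] :
    TopologicalSpace (H →L[ℂ] H) :=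
  ⨅ (x : lp (fun _ : ℕ => H) 2) (y : lp (fun _ : ℕ => H) 2),
    TopologicalSpace.induced (fun T : H →L[ℂ] H => ∑' n, inner ℂ (y n) (T (x n))) inferInstance

variable {H}

/-- An ideal of `𝓜(H)` is weak-* closed if it is closed in the relative weak-* topology of
`𝓜(H)`. -/
def IsWeakStarClosed (𝔞 : Ideal (multiplierAlgebra H)) : Prop :=
  IsClosed[TopologicalSpace.induced Subtype.val (weakStarTopology H)]
    (𝔞 : Set (multiplierAlgebra H))

/-- The closed subspace `[𝔞 H]` spanned by the vectors `M_φ f` with `φ ∈ 𝔞` and `f ∈ H`. -/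
def idealRange (𝔞 : Ideal (multiplierAlgebra H)) : Submodule ℂ H :=
  (Submodule.span ℂ {g : H | ∃ T ∈ 𝔞, ∃ f : H, T.1 f = g}).topologicalClosure

/-- The Hilbert space `H_𝔞 = H ⊖ [𝔞 H]`, the orthogonal complement of `[𝔞 H]` in `H`. -/
def QuotientSpace (𝔞 : Ideal (multiplierAlgebra H)) : Type _ := ((idealRange 𝔞)ᗮ : Submodule ℂ H)

instance (𝔞 : Ideal (multiplierAlgebra H)) : NormedAddCommGroup (QuotientSpace 𝔞) :=
  inferInstanceAs (NormedAddCommGroup ((idealRange 𝔞)ᗮ : Submodule ℂ H))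

instance (𝔞 : Ideal (multiplierAlgebra H)) : InnerProductSpace ℂ (QuotientSpace 𝔞) :=
  inferInstanceAs (InnerProductSpace ℂ ((idealRange 𝔞)ᗮ : Submodule ℂ H))

instance (𝔞 : Ideal (multiplierAlgebra H)) : CompleteSpace (QuotientSpace 𝔞) :=
  inferInstanceAs (CompleteSpace ((idealRange 𝔞)ᗮ : Submodule ℂ H))

/-- The isometric inclusion of `H_𝔞` in `H`. -/
def inclusion (𝔞 : Ideal (multiplierAlgebra H)) : QuotientSpace 𝔞 →L[ℂ] H :=
  (idealRange 𝔞)ᗮ.subtypeL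

/-- The orthogonal projection of `H` onto `H_𝔞`. -/
def projection (𝔞 : Ideal (multiplierAlgebra H)) : H →L[ℂ] QuotientSpace 𝔞 :=
  (idealRange 𝔞)ᗮ.orthogonalProjectionOnto

theorem projection_inclusion (𝔞 : Ideal (multiplierAlgebra H)) (x : QuotientSpace 𝔞) :
    projection 𝔞 (inclusion 𝔞 x) = x :=
  Submodule.orthogonalProjectionOnto_mem_subspace_eq_self (K := (idealRange 𝔞)ᗮ) x

theorem idealRange_orthogonal_orthogonal (𝔞 : Ideal (multiplierAlgebra H)) :
    (idealRange 𝔞)ᗮᗮ = idealRange 𝔞 := by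
  have : CompleteSpace (idealRange 𝔞) :=
    (Submodule.isClosed_topologicalClosure _).completeSpace_coe
  exact Submodule.orthogonal_orthogonal _

theorem projection_eq_zero (𝔞 : Ideal (multiplierAlgebra H)) {u : H} (hu : u ∈ idealRange 𝔞) :
    projection 𝔞 u = 0 := by
  refine (Submodule.orthogonalProjectionOnto_eq_zero_iff (K := (idealRange 𝔞)ᗮ)).2 ?_
  rwa [idealRange_orthogonal_orthogonal]

theorem sub_projection_mem (𝔞 : Ideal (multiplierAlgebra H)) (u : H) :
    u - inclusion 𝔞 (projection 𝔞 u) ∈ idealRange 𝔞 :=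
  (idealRange_orthogonal_orthogonal 𝔞).le
    (Submodule.sub_starProjection_mem_orthogonal (K := (idealRange 𝔞)ᗮ) u)

theorem idealRange_invariant (𝔞 : Ideal (multiplierAlgebra H)) (T : multiplierAlgebra H)
    {u : H} (hu : u ∈ idealRange 𝔞) : T.1 u ∈ idealRange 𝔞 := by
  have key : Submodule.span ℂ {g : H | ∃ T ∈ 𝔞, ∃ f : H, T.1 f = g} ≤
      (Submodule.span ℂ {g : H | ∃ T ∈ 𝔞, ∃ f : H, T.1 f = g}).comap T.1.toLinearMap := by
    rw [Submodule.span_le]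
    rintro g ⟨S, hS, f, rfl⟩
    exact Submodule.subset_span ⟨T * S, 𝔞.mul_mem_left T hS, f, rfl⟩
  exact map_mem_closure T.1.continuous hu fun v hv => key hv

/-- The functional calculus `Γ : 𝓜(H) → B(H_𝔞)`, `Γ(ψ) = P_{H_𝔞} M_ψ |_{H_𝔞}`. -/
def functionalCalculus (𝔞 : Ideal (multiplierAlgebra H)) :
    multiplierAlgebra H →ₐ[ℂ] (QuotientSpace 𝔞 →L[ℂ] QuotientSpace 𝔞) where
  toFun T := projection 𝔞 ∘L T.1 ∘L inclusion 𝔞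
  map_one' := ContinuousLinearMap.ext fun x => projection_inclusion 𝔞 x
  map_mul' S T := by
    refine ContinuousLinearMap.ext fun x => ?_
    change projection 𝔞 (S.1 (T.1 (inclusion 𝔞 x))) =
      projection 𝔞 (S.1 (inclusion 𝔞 (projection 𝔞 (T.1 (inclusion 𝔞 x)))))
    rw [← sub_eq_zero, ← map_sub, ← map_sub]
    exact projection_eq_zero 𝔞 (idealRange_invariant 𝔞 S (sub_projection_mem 𝔞 _))
  map_zero' := ContinuousLinearMap.ext fun _ => map_zero (projection 𝔞)
  map_add' S T := ContinuousLinearMap.ext fun x =>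
    map_add (projection 𝔞) (S.1 (inclusion 𝔞 x)) (T.1 (inclusion 𝔞 x))
  commutes' c := by
    refine ContinuousLinearMap.ext fun x => ?_
    change projection 𝔞 (c • inclusion 𝔞 x) = c • x
    rw [map_smul, projection_inclusion]

end Multipliers

/-! ### The algebras generated by the polynomials -/

section Polynomials

variable {d : ℕ} (H : Type*) [NormedAddCommGroup H] [InnerProductSpace ℂ H]
  [CompleteSpace H] [RKHS ℂ H (UnitBall d) ℂ]

/-- The polynomial multipliers. -/
def polynomialMultipliers : Subalgebra ℂ (multiplierAlgebra H) where
  carrier := {T | ∃ p : MvPolynomial (Fin d) ℂ,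
    IsMulOperator (fun z : UnitBall d => MvPolynomial.eval (fun j => z.1 j) p) T.1}
  mul_mem' := by
    rintro S T ⟨p, hp⟩ ⟨q, hq⟩
    refine ⟨p * q, fun f z => ?_⟩
    change S.1 (T.1 f) z = _
    rw [hp, hq]
    simp only [map_mul, mul_assoc]
  add_mem' := by
    rintro S T ⟨p, hp⟩ ⟨q, hq⟩
    refine ⟨p + q, fun f z => ?_⟩
    change (S.1 f + T.1 f) z = _
    rw [RKHS.coe_add, Pi.add_apply, hp, hq]
    simp only [map_add, add_mul]
  algebraMap_mem' := fun c => ⟨MvPolynomial.C c, fun f z => by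
    change (c • f) z = _
    simp⟩

/-- `𝓐(H)`: the norm closure of the polynomials in `𝓜(H)`. -/
def polynomialAlgebra : Subalgebra ℂ (multiplierAlgebra H) :=
  (polynomialMultipliers H).topologicalClosure

variable {H}

/-- `𝓐_𝔞`: the norm closure of `Γ(𝓐(H))` in `B(H_𝔞)`. -/
def quotientAlgebra (𝔞 : Ideal (multiplierAlgebra H)) :
    Subalgebra ℂ (QuotientSpace 𝔞 →L[ℂ] QuotientSpace 𝔞) :=
  ((polynomialAlgebra H).map (functionalCalculus 𝔞)).topologicalClosure

instance (𝔞 : Ideal (multiplierAlgebra H)) : CompleteSpace (quotientAlgebra 𝔞) :=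
  (Subalgebra.isClosed_topologicalClosure _).completeSpace_coe

end Polynomials

/-! ### Complete isometries -/

section CompleteIsometry

variable {K : Type*} [NormedAddCommGroup K] [InnerProductSpace ℂ K]

/-- An `n × n` matrix of operators on `K`, as an operator on the Hilbert space direct sum
`K^{(n)}`: the `i`-th coordinate of the image of `x` is `∑ j, T i j (x j)`. -/
def matrixOperator {n : ℕ} (T : Matrix (Fin n) (Fin n) (K →L[ℂ] K)) :
    PiLp 2 (fun _ : Fin n => K) →L[ℂ] PiLp 2 (fun _ : Fin n => K) :=
  (PiLp.continuousLinearEquiv 2 ℂ (fun _ : Fin n => K)).symm.toContinuousLinearMap ∘L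
    ContinuousLinearMap.pi fun i =>
      ∑ j, T i j ∘L PiLp.proj 2 (fun _ : Fin n => K) j

theorem matrixOperator_apply {n : ℕ} (T : Matrix (Fin n) (Fin n) (K →L[ℂ] K))
    (x : PiLp 2 (fun _ : Fin n => K)) (i : Fin n) :
    matrixOperator T x i = ∑ j, T i j (x j) := by
  simp [matrixOperator]

/-- The identification of `M_n(C(X))` with `C(X, M_n)`, where `M_n` is the algebra of operators on
the Euclidean space `ℂ^n`. The sup norm on the latter is the norm of the C*-algebra `M_n(C(X))`. -/
def matrixFunction {X : Type*} [TopologicalSpace X] {n : ℕ}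
    (F : Matrix (Fin n) (Fin n) C(X, ℂ)) :
    C(X, EuclideanSpace ℂ (Fin n) →L[ℂ] EuclideanSpace ℂ (Fin n)) where
  toFun x := Matrix.toEuclideanCLM (n := Fin n) (𝕜 := ℂ) (F.map fun f => f x)
  continuous_toFun := by
    have h1 : Continuous fun M : Matrix (Fin n) (Fin n) ℂ =>
        Matrix.toEuclideanCLM (n := Fin n) (𝕜 := ℂ) M :=
      LinearMap.continuous_of_finiteDimensional
        (Matrix.toEuclideanCLM (n := Fin n) (𝕜 := ℂ)).toAlgEquiv.toLinearMap
    refine h1.comp ?_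
    exact continuous_pi fun i => continuous_pi fun j => (F i j).continuous

/-- A linear map from an operator algebra `A ⊆ B(K)` to `C(X)` is completely isometric if the
maps it induces on `n × n` matrices are isometric for every `n ≥ 1`. -/
def IsCompletelyIsometric {A : Subalgebra ℂ (K →L[ℂ] K)} {X : Type*} [TopologicalSpace X]
    [CompactSpace X] (g : A →ₗ[ℂ] C(X, ℂ)) : Prop :=
  ∀ n : ℕ, 1 ≤ n → ∀ T : Matrix (Fin n) (Fin n) A,
    ‖matrixFunction (T.map g)‖ = ‖matrixOperator (T.map Subtype.val)‖

end CompleteIsometry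

end NPSpace

end

open NPSpace

open NPSpace

/-! Expanding `⟨z,w⟩ ^ n` over words of length `n` turns `1 - 1/k` into `∑ φ_i(z) conj (φ_i(w))`,
where the `φ_i` are monomials weighted by `√b_n`. Hence `k (1 - ∑ φ_i ⊗ conj φ_i) = 1`, which says
that the `M_{φ_i}` form a row contraction with `∑ M_i M_i^* = I - k_0 ⊗ k_0`
(`exists_row_of_kernel_factor`). Since `H_𝔞` is coinvariant, the compressions `T_i` satisfy `∑
‖T_i^* y‖² = ‖y‖² - |y(0)|²`. As `dim H_𝔞 > 1`, some nonzero `y` vanishes at `0`, and on it the row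
attains norm `1`.

Characters see a strictly smaller row. A character sends `T_i` to `φ_i(λ)`, with `λ ∈ ℂ^d` its
values at the coordinates. A completely isometric Gelfand transform makes the scalar row
contractive, so `∑ b_n ‖λ‖^{2n}` converges. Regularity together with `∑ b_n < 1` makes `1` the
radius of convergence of `∑ b_n t^n` (`le_one_of_summable`), so `‖λ‖ ≤ 1` and `∑ |φ_i(λ)|² ≤ ∑ b_n`.
Carrying this bound back to the operators on finite subrows, and then letting them exhaust the row,
gives `‖y‖² ≤ (∑ b_n) ‖y‖²` for the above `y`, a contradiction. -/

/-! ### Power series coefficients and the renewal recurrence -/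

/-- A power series that vanishes on the unit disc has vanishing coefficients. -/
theorem coeff_eq_zero_of_hasSum_zero {c : ℕ → ℂ}
    (h : ∀ ζ : ℂ, ‖ζ‖ < 1 → HasSum (fun n => c n * ζ ^ n) 0) (n : ℕ) : c n = 0 := by
  have h1 : HasFPowerSeriesAt (fun _ : ℂ => (0 : ℂ)) (FormalMultilinearSeries.ofScalars ℂ c) 0 := by
    rw [hasFPowerSeriesAt_iff]
    filter_upwards [Metric.ball_mem_nhds (0 : ℂ) one_pos] with ζ hζ
    simpa [FormalMultilinearSeries.coeff_ofScalars, mul_comm] using h ζ (by simpa using hζ)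
  have h2 := h1.eq_zero
  rw [FormalMultilinearSeries.ofScalars_series_eq_zero] at h2
  exact congrFun h2 n

/-- If `A(ζ) = ∑ aₙ ζⁿ` and `1 - 1 / A(ζ) = ∑_{n ≥ 1} bₙ ζⁿ` on the unit disc, then
`a = δ₀ + a * b`. -/
theorem coeff_recurrence {a b : ℕ → ℝ}
    (h : ∀ ζ : ℂ, ‖ζ‖ < 1 → ∃ κ : ℂ, κ ≠ 0 ∧ HasSum (fun n => (a n : ℂ) * ζ ^ n) κ ∧
      HasSum (fun n => (b n : ℂ) * ζ ^ n) (1 - 1 / κ)) (n : ℕ) :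
    a n = (if n = 0 then 1 else 0) + ∑ k ∈ Finset.range (n + 1), a k * b (n - k) := by
  have key := coeff_eq_zero_of_hasSum_zero (c := fun n => (a n : ℂ) -
    ((if n = 0 then 1 else 0) + ∑ k ∈ Finset.range (n + 1), (a k : ℂ) * b (n - k))) ?_ n
  · rw [sub_eq_zero] at key
    rw [← Complex.ofReal_inj, key]
    push_cast
    split_ifs <;> simp
  intro ζ hζ
  obtain ⟨κ, hκ, ha, hb⟩ := h ζ hζ
  have hprod := hasSum_sum_range_mul_of_summable_norm ha.summable.norm hb.summable.norm
  rw [ha.tsum_eq, hb.tsum_eq] at hprod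
  have hdelta : HasSum (fun n : ℕ => if n = 0 then (1 : ℂ) else 0) 1 := hasSum_ite_eq 0 1
  -- The identity `κ = 1 + κ (1 - 1/κ)`, read as a Cauchy product, is the recurrence.
  have hz : κ - (1 + κ * (1 - 1 / κ)) = 0 := by
    field_simp
    ring
  have hsum := ha.sub (hdelta.add hprod)
  rw [hz] at hsum
  refine Eq.mp (congrArg (fun f => HasSum f (0 : ℂ)) (funext fun n => ?_)) hsum
  rw [sub_mul, add_mul, Finset.sum_mul]
  congr 2
  · split_ifs with hn <;> simp [hn]
  · refine Finset.sum_congr rfl fun k hk => ?_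
    have hk' : k + (n - k) = n := by have := Finset.mem_range.1 hk; omega
    conv_rhs => rw [← hk', pow_add]
    simp only [Nat.add_sub_cancel_left]
    ring

/-- Partial sums of the coefficients of a power series with non-negative coefficients are bounded
by any bound of its values on `[0, 1)`. -/
theorem sum_range_le_of_hasSum_le {b : ℕ → ℝ} {C : ℝ} (hb : ∀ n, 0 ≤ b n)
    (h : ∀ t : ℝ, 0 ≤ t → t < 1 → ∃ s ≤ C, HasSum (fun n => b n * t ^ n) s) (N : ℕ) :
    ∑ n ∈ Finset.range N, b n ≤ C := by
  have hcont : Tendsto (fun t : ℝ => ∑ n ∈ Finset.range N, b n * t ^ n) (𝓝[<] 1)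
      (𝓝 (∑ n ∈ Finset.range N, b n * 1 ^ n)) :=
    ((continuous_finsetSum _ fun n _ => by fun_prop).tendsto 1).mono_left nhdsWithin_le_nhds
  simp only [one_pow, mul_one] at hcont
  refine le_of_tendsto hcont ?_
  filter_upwards [Ioo_mem_nhdsLT (zero_lt_one' ℝ)] with t ht
  obtain ⟨s, hs, hsum⟩ := h t ht.1.le ht.2
  exact (sum_le_hasSum _ (fun n _ => mul_nonneg (hb n) (pow_nonneg ht.1.le n)) hsum).trans hs

/-- If `a = δ₀ + a * b` with non-negative coefficients and `g = ∑ bₙ tⁿ < 1`, then `∑ aₙ tⁿ`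
converges. -/
theorem summable_of_recurrence {a b : ℕ → ℝ} (ha : ∀ n, 0 ≤ a n) (hb : ∀ n, 0 ≤ b n)
    (hrec : ∀ n, a n = (if n = 0 then 1 else 0) + ∑ k ∈ Finset.range (n + 1), a k * b (n - k))
    {t g : ℝ} (ht : 0 ≤ t) (hg : HasSum (fun n => b n * t ^ n) g) (hg1 : g < 1) :
    Summable fun n => a n * t ^ n := by
  -- The partial sums `A_N` satisfy `A_N ≤ 1 + A_N g`, because the convolution is summed over a
  -- triangle; this gives the bound `1 / (1 - g)`.
  refine summable_of_sum_range_le (c := 1 / (1 - g))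
    (fun n => mul_nonneg (ha n) (pow_nonneg ht n)) fun N => ?_
  rw [le_div_iff₀ (by linarith)]
  have h1 : ∑ n ∈ Finset.range N, a n * t ^ n =
      ∑ n ∈ Finset.range N, (if n = 0 then (1 : ℝ) else 0) +
        ∑ m ∈ Finset.range N, ∑ k ∈ Finset.range (N - m), a m * t ^ m * (b k * t ^ k) := by
    rw [← Finset.sum_range_diag_flip, ← Finset.sum_add_distrib]
    refine Finset.sum_congr rfl fun n _ => ?_
    conv_lhs => rw [hrec n]
    rw [add_mul, Finset.sum_mul]
    congr 1
    · split_ifs with hn <;> simp [hn]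
    · refine Finset.sum_congr rfl fun k hk => ?_
      have hk' : k + (n - k) = n := by have := Finset.mem_range.1 hk; omega
      conv_lhs => rw [← hk', pow_add]
      simp only [Nat.add_sub_cancel_left]
      ring
  have h2 : ∑ n ∈ Finset.range N, (if n = 0 then (1 : ℝ) else 0) ≤ 1 := by
    rw [Finset.sum_ite_eq']
    split_ifs <;> norm_num
  have h3 : ∑ m ∈ Finset.range N, ∑ k ∈ Finset.range (N - m), a m * t ^ m * (b k * t ^ k) ≤
      (∑ m ∈ Finset.range N, a m * t ^ m) * g := by
    rw [Finset.sum_mul]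
    refine Finset.sum_le_sum fun m _ => ?_
    rw [← Finset.mul_sum]
    exact mul_le_mul_of_nonneg_left
      (sum_le_hasSum _ (fun k _ => mul_nonneg (hb k) (pow_nonneg ht k)) hg)
      (mul_nonneg (ha m) (pow_nonneg ht m))
  linarith

/-- If `a = δ₀ + a * b` with `aₙ / aₙ₊₁ → 1` and `∑ bₙ < 1`, then the power series `∑ bₙ tⁿ`
converges at no point beyond `1`. -/
theorem le_one_of_summable {a b : ℕ → ℝ} (ha : ∀ n, 0 < a n) (hb : ∀ n, 0 ≤ b n)
    (hlim : Tendsto (fun n => a n / a (n + 1)) atTop (𝓝 1))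
    (hrec : ∀ n, a n = (if n = 0 then 1 else 0) + ∑ k ∈ Finset.range (n + 1), a k * b (n - k))
    (hsum : ∑' n, b n < 1) {L : ℝ} (hL : Summable fun n => b n * L ^ n) : L ≤ 1 := by
  by_contra! h1L
  have hbound : ∀ n, ∀ t ∈ Set.Icc 0 L, ‖b n * t ^ n‖ ≤ b n * L ^ n := fun n t ht => by
    rw [Real.norm_of_nonneg (mul_nonneg (hb n) (pow_nonneg ht.1 n))]
    exact mul_le_mul_of_nonneg_left (pow_le_pow_left₀ ht.1 ht.2 n) (hb n)
  -- Convergence at `L > 1` would make the sum continuous at `1`, so it would stay below `1` at some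
  -- `t > 1`.
  have hcont : ContinuousOn (fun t => ∑' n, b n * t ^ n) (Set.Icc 0 L) :=
    continuousOn_tsum (fun n => by fun_prop) hL hbound
  have hcat : ContinuousAt (fun t => ∑' n, b n * t ^ n) 1 :=
    hcont.continuousAt (Icc_mem_nhds zero_lt_one h1L)
  have hev : ∀ᶠ t in 𝓝[>] (1 : ℝ), ∑' n, b n * t ^ n < 1 :=
    (hcat.eventually_lt_const (by simpa using hsum)).filter_mono nhdsWithin_le_nhds
  obtain ⟨t, hlt, ht⟩ := (hev.and (Ioo_mem_nhdsGT h1L)).exists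
  have ht0 : 0 < t := one_pos.trans ht.1
  have hst : Summable fun n => b n * t ^ n :=
    Summable.of_norm_bounded hL fun n => hbound n t ⟨ht0.le, ht.2.le⟩
  -- The recurrence makes `∑ a_n t^n` converge there, whereas its term ratios tend to `t > 1`.
  refine not_summable_of_ratio_test_tendsto_gt_one (l := t) ht.1 ?_
    (summable_of_recurrence (fun n => (ha n).le) hb hrec ht0.le hst.hasSum hlt)
  have : Tendsto (fun n => (a n / a (n + 1))⁻¹ * t) atTop (𝓝 (1⁻¹ * t)) :=
    (hlim.inv₀ one_ne_zero).mul_const t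
  simp only [inv_one, one_mul] at this
  refine this.congr fun n => ?_
  have h1 := (ha n).ne'
  have h2 := (ha (n + 1)).ne'
  rw [Real.norm_of_nonneg (mul_nonneg (ha n).le (pow_nonneg ht0.le _)),
    Real.norm_of_nonneg (mul_nonneg (ha (n + 1)).le (pow_nonneg ht0.le _)), pow_succ]
  field_simp

/-! ### Kernel functions and the row of multipliers -/

section
variable {X : Type*} (H : Type*) [NormedAddCommGroup H] [InnerProductSpace ℂ H]
  [CompleteSpace H] [RKHS ℂ H X ℂ]

/-- The kernel function `k_w`. -/
noncomputable def kernelFunction (w : X) : H := RKHS.kerFun H w 1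

variable {H}

theorem inner_kernelFunction_left (w : X) (f : H) : inner ℂ (kernelFunction H w) f = f w := by
  simp [kernelFunction]

theorem kernelFunction_apply (z w : X) : kernelFunction H w z = reproducingKernel H z w :=
  RKHS.kerFun_apply H w 1 z

theorem reproducingKernel_conj_symm (z w : X) :
    conj (reproducingKernel H z w) = reproducingKernel H w z := by
  rw [← kernelFunction_apply, ← inner_kernelFunction_left, inner_conj_symm,
    inner_kernelFunction_left, kernelFunction_apply]

/-- A vector orthogonal to every `k_w` vanishes pointwise. Stated for formal combinations so that an
operator can be prescribed on the kernel functions and extended by density. -/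
theorem denseRange_linearCombination_kernelFunction :
    DenseRange (Finsupp.linearCombination ℂ (kernelFunction H : X → H)) := by
  have h : Dense ((Submodule.span ℂ (Set.range (kernelFunction H : X → H)) : Submodule ℂ H) :
      Set H) := by
    rw [Submodule.dense_iff_topologicalClosure_eq_top, Submodule.topologicalClosure_eq_top_iff,
      Submodule.eq_bot_iff]
    intro f hf
    refine RKHS.ext fun z => ?_
    rw [← inner_kernelFunction_left z f,
      Submodule.inner_right_of_mem_orthogonal (Submodule.subset_span (Set.mem_range_self z)) hf]
    simp
  rw [← Finsupp.range_linearCombination] at h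
  exact h

/-- If `k (1 - ∑ i, φ_i ⊗ conj φ_i) = 1` and `k` is normalized at `o`, then the `φ_i` are
multipliers, and `∑ i, M_{φ_i} M_{φ_i}^* = I - k_o ⊗ k_o`. -/
theorem exists_row_of_kernel_factor {ι : Type*} (φ : ι → X → ℂ) (o : X)
    (ho : ∀ z, reproducingKernel H z o = 1)
    (hφ : ∀ z w, HasSum (fun i => φ i z * conj (φ i w) * reproducingKernel H z w)
      (reproducingKernel H z w - 1)) :
    ∃ M : ι → H →L[ℂ] H, (∀ i, IsMulOperator (φ i) (M i)) ∧
      ∀ x : H, HasSum (fun i => ‖(M i).adjoint x‖ ^ 2) (‖x‖ ^ 2 - ‖x o‖ ^ 2) := by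
  have hin : ∀ i z w, inner ℂ (conj (φ i z) • kernelFunction H z)
      (conj (φ i w) • kernelFunction H w) =
      φ i z * conj (φ i w) * reproducingKernel H z w := fun i z w => by
    rw [inner_smul_left, inner_smul_right, inner_kernelFunction_left, kernelFunction_apply,
      RCLike.conj_conj, mul_assoc]
  have hmem : ∀ w, Memℓp (fun i => conj (φ i w) • kernelFunction H w) 2 := fun w => by
    refine memℓp_gen ?_
    have := (Complex.hasSum_re (hφ w w)).summable
    refine this.congr fun i => ?_
    rw [← hin, ENNReal.toReal_ofNat, Real.rpow_two]
    exact inner_self_eq_norm_sq (𝕜 := ℂ) _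
  -- `v w` is what the column `(M_i^*)_i` must do to `k_w`, because `M_φ^* k_w = conj (φ w) k_w`.
  let v : X → lp (fun _ : ι => H) 2 := fun w => ⟨_, hmem w⟩
  let e := Finsupp.linearCombination ℂ (kernelFunction H : X → H)
  let s := Finsupp.linearCombination ℂ v
  have hv : ∀ z w, inner ℂ (v z) (v w) = reproducingKernel H z w - 1 := fun z w => by
    refine (lp.hasSum_inner (v z) (v w)).unique ?_
    simpa only [← hin] using hφ z w
  -- The Gram matrix of `v` is `k - 1`, that of the kernel functions minus a rank-one term. Hence
  -- `k_w ↦ v w` extends to a contraction `V`, and no prior boundedness of the `φ_i` is needed.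
  have hs : ∀ x y, inner ℂ (s x) (s y) =
      inner ℂ (e x) (e y) - conj (e x o) * e y o := by
    intro x y
    induction x using Finsupp.induction_linear with
    | zero => simp
    | add x₁ x₂ h₁ h₂ =>
      simp only [map_add, inner_add_left, h₁, h₂, RKHS.coe_add, Pi.add_apply]; ring
    | single z c =>
      induction y using Finsupp.induction_linear with
      | zero => simp
      | add x₁ x₂ h₁ h₂ =>
        simp only [map_add, inner_add_right, h₁, h₂, RKHS.coe_add, Pi.add_apply]; ring
      | single w c' =>
        have ho' : ∀ z, reproducingKernel H o z = 1 := fun z => by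
          rw [← reproducingKernel_conj_symm, ho, map_one]
        simp only [s, e, Finsupp.linearCombination_single, inner_smul_left, inner_smul_right, hv,
          inner_kernelFunction_left, kernelFunction_apply, RKHS.coe_smul, Pi.smul_apply, ho',
          smul_eq_mul, map_mul, map_one]
        ring
  have hs' : ∀ x, ‖s x‖ ^ 2 = ‖e x‖ ^ 2 - ‖e x o‖ ^ 2 := fun x => by
    have := hs x x
    rw [inner_self_eq_norm_sq_to_K, inner_self_eq_norm_sq_to_K, RCLike.conj_mul] at this
    exact_mod_cast this
  have hdense : DenseRange e := denseRange_linearCombination_kernelFunction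
  have hle : ∀ x, ‖s x‖ ≤ 1 * ‖e x‖ := fun x => by
    rw [one_mul]
    rw [← sq_le_sq₀ (norm_nonneg _) (norm_nonneg _), hs']
    have := sq_nonneg ‖e x o‖
    linarith
  let V : H →L[ℂ] lp (fun _ : ι => H) 2 := s.extendOfNorm e
  have hV : ∀ x, V (e x) = s x := LinearMap.extendOfNorm_eq hdense ⟨1, hle⟩
  have hVnorm : ∀ x, ‖V x‖ ^ 2 = ‖x‖ ^ 2 - ‖x o‖ ^ 2 := by
    refine hdense.induction ?_ (isClosed_eq (by fun_prop) ?_)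
    · rintro _ ⟨x, rfl⟩
      rw [hV, hs']
    · exact ((continuous_norm.pow 2).sub ((RKHS.continuous_eval o).norm.pow 2))
  let R : ι → H →L[ℂ] H := fun i => (lp.evalCLM ℂ (fun _ : ι => H) 2 i) ∘L V
  have hVk : ∀ w, V (kernelFunction H w) = v w := fun w => by
    have := hV (Finsupp.single w 1)
    simpa [e, s] using this
  refine ⟨fun i => (R i).adjoint, fun i f z => ?_, fun x => ?_⟩
  · rw [← inner_kernelFunction_left, ContinuousLinearMap.adjoint_inner_right]
    change inner ℂ (V (kernelFunction H z) i) f = _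
    rw [hVk]
    change inner ℂ (conj (φ i z) • kernelFunction H z) f = _
    rw [inner_smul_left, RCLike.conj_conj, inner_kernelFunction_left]
  · simp only [ContinuousLinearMap.adjoint_adjoint, ← hVnorm]
    have := lp.hasSum_norm (p := 2) (by norm_num) (V x)
    simp only [ENNReal.toReal_ofNat, Real.rpow_two] at this
    exact this
end

/-! ### Norms of rows and complete isometries -/

/-- The matrix with first row `A` and zeros elsewhere. -/
def rowMatrix {α : Type*} [Zero α] {m : ℕ} (A : Fin (m + 1) → α) :
    Matrix (Fin (m + 1)) (Fin (m + 1)) α :=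
  Matrix.of fun i j => if i = 0 then A j else 0

theorem rowMatrix_map {α β : Type*} [Zero α] [Zero β] {m : ℕ} (A : Fin (m + 1) → α) (f : α → β)
    (hf : f 0 = 0) : (rowMatrix A).map f = rowMatrix fun j => f (A j) := by
  ext i j
  by_cases hi : i = 0 <;> simp [rowMatrix, hi, hf]

section
variable {K : Type*} [NormedAddCommGroup K] [InnerProductSpace ℂ K]

theorem norm_matrixOperator_rowMatrix_apply {m : ℕ} (A : Fin (m + 1) → K →L[ℂ] K)
    (x : PiLp 2 fun _ : Fin (m + 1) => K) :
    ‖matrixOperator (rowMatrix A) x‖ = ‖∑ j, A j (x j)‖ := by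
  rw [PiLp.norm_eq_of_L2, Fin.sum_univ_succ]
  simp [matrixOperator_apply, rowMatrix, Fin.succ_ne_zero]

variable [CompleteSpace K]

/-- The norm of a row of operators, in terms of the adjoint column. -/
theorem norm_matrixOperator_rowMatrix_le_iff {m : ℕ} (A : Fin (m + 1) → K →L[ℂ] K) {C : ℝ}
    (hC : 0 ≤ C) : ‖matrixOperator (rowMatrix A)‖ ≤ C ↔
      ∀ y, ∑ j, ‖(A j).adjoint y‖ ^ 2 ≤ C ^ 2 * ‖y‖ ^ 2 := by
  constructor
  · intro h y
    -- Testing the row on its own adjoint column gives `re ⟨y, ∑ A_j x_j⟩ = ‖x‖²`.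
    let x : PiLp 2 fun _ : Fin (m + 1) => K := WithLp.toLp 2 fun j => (A j).adjoint y
    have hx : ‖x‖ ^ 2 = ∑ j, ‖(A j).adjoint y‖ ^ 2 := PiLp.norm_sq_eq_of_L2 _ _
    have h1 : ‖x‖ ^ 2 ≤ ‖y‖ * (C * ‖x‖) := by
      calc ‖x‖ ^ 2 = RCLike.re (inner ℂ y (∑ j, A j (x j))) := by
            rw [hx, inner_sum, map_sum]
            refine Finset.sum_congr rfl fun j _ => ?_
            rw [← ContinuousLinearMap.adjoint_inner_left, ← inner_self_eq_norm_sq (𝕜 := ℂ)]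
        _ ≤ ‖y‖ * ‖∑ j, A j (x j)‖ := re_inner_le_norm _ _
        _ ≤ ‖y‖ * (C * ‖x‖) := by
            rw [← norm_matrixOperator_rowMatrix_apply]
            gcongr
            exact (matrixOperator (rowMatrix A)).le_of_opNorm_le h x
    rw [← hx]
    rcases (norm_nonneg x).eq_or_lt with h0 | h0
    · rw [← h0, zero_pow two_ne_zero]; positivity
    · have h2 : ‖x‖ ≤ C * ‖y‖ := by
        refine le_of_mul_le_mul_right ?_ h0
        nlinarith
      rw [← mul_pow]
      gcongr
  · intro h
    refine ContinuousLinearMap.opNorm_le_bound _ hC fun x => ?_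
    rw [norm_matrixOperator_rowMatrix_apply]
    set y := ∑ j, A j (x j) with hy
    have h1 : ‖y‖ ^ 2 ≤ ∑ j, ‖(A j).adjoint y‖ * ‖x j‖ := by
      calc ‖y‖ ^ 2 = RCLike.re (inner ℂ y (∑ j, A j (x j))) :=
            (inner_self_eq_norm_sq (𝕜 := ℂ) y).symm
        _ = ∑ j, RCLike.re (inner ℂ ((A j).adjoint y) (x j)) := by
            rw [inner_sum, map_sum]
            simp only [ContinuousLinearMap.adjoint_inner_left]
        _ ≤ _ := Finset.sum_le_sum fun j _ => re_inner_le_norm _ _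
    have h2 : (∑ j, ‖(A j).adjoint y‖ * ‖x j‖) ^ 2 ≤ (C * ‖y‖ * ‖x‖) ^ 2 := by
      refine (Finset.sum_mul_sq_le_sq_mul_sq _ _ _).trans ?_
      rw [← PiLp.norm_sq_eq_of_L2, mul_pow, mul_pow]
      gcongr
      exact h y
    have h3 := h1.trans ((sq_le_sq₀ (by positivity) (by positivity)).1 h2)
    rcases (norm_nonneg y).eq_or_lt with h0 | h0
    · rw [← h0]; positivity
    · refine le_of_mul_le_mul_right ?_ h0
      nlinarith

/-- Treating scalars as operators on the Hilbert space `ℂ` lets the same row criterion apply to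
character values. -/
theorem toEuclideanCLM_eq_matrixOperator {n : ℕ} (M : Matrix (Fin n) (Fin n) ℂ) :
    Matrix.toEuclideanCLM (n := Fin n) (𝕜 := ℂ) M =
      matrixOperator (M.map fun c => c • ContinuousLinearMap.id ℂ ℂ) := by
  ext x i
  simp [matrixOperator_apply, Matrix.ofLp_toEuclideanCLM, Matrix.mulVec, dotProduct]

theorem norm_toEuclideanCLM_rowMatrix_le_iff {m : ℕ} (c : Fin (m + 1) → ℂ) {C : ℝ}
    (hC : 0 ≤ C) : ‖Matrix.toEuclideanCLM (n := Fin (m + 1)) (𝕜 := ℂ) (rowMatrix c)‖ ≤ C ↔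
      ∑ j, ‖c j‖ ^ 2 ≤ C ^ 2 := by
  rw [toEuclideanCLM_eq_matrixOperator,
    rowMatrix_map c (fun c => c • ContinuousLinearMap.id ℂ ℂ)
      (zero_smul ℂ (ContinuousLinearMap.id ℂ ℂ)),
    norm_matrixOperator_rowMatrix_le_iff _ hC]
  have h : ∀ y : ℂ, ∑ j, ‖(c j • ContinuousLinearMap.id ℂ ℂ).adjoint y‖ ^ 2 =
      (∑ j, ‖c j‖ ^ 2) * ‖y‖ ^ 2 := fun y => by
    rw [Finset.sum_mul]
    refine Finset.sum_congr rfl fun j _ => ?_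
    rw [map_smulₛₗ, ContinuousLinearMap.adjoint_id]
    simp [mul_pow]
  simp only [h]
  refine ⟨fun H => by simpa using H 1, fun H y => by gcongr⟩

/-- A completely isometric map to `C(X)` preserves the norms of finite rows. -/
theorem NPSpace.IsCompletelyIsometric.sum_sq_le_iff {A : Subalgebra ℂ (K →L[ℂ] K)} {X : Type*}
    [TopologicalSpace X] [CompactSpace X] {g : A →ₗ[ℂ] C(X, ℂ)} (hg : IsCompletelyIsometric g)
    {ι : Type*} (F : Finset ι) (T : ι → A) {C : ℝ} (hC : 0 ≤ C) :
    (∀ x, ∑ i ∈ F, ‖g (T i) x‖ ^ 2 ≤ C ^ 2) ↔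
      ∀ y, ∑ i ∈ F, ‖(T i).1.adjoint y‖ ^ 2 ≤ C ^ 2 * ‖y‖ ^ 2 := by
  -- A row matrix needs a first row, so the empty family is treated separately.
  obtain hn | ⟨m, hm⟩ : F.card = 0 ∨ ∃ m, F.card = m + 1 := by
    cases F.card <;> simp
  · rw [Finset.card_eq_zero] at hn
    subst hn
    simp only [Finset.sum_empty]
    exact ⟨fun _ y => by positivity, fun _ x => by positivity⟩
  have key : ∀ f : ι → ℝ, ∑ i ∈ F, f i = ∑ j, f ((F.equivFinOfCardEq hm).symm j) := fun f => by
    rw [← Finset.sum_coe_sort, ← (F.equivFinOfCardEq hm).symm.sum_comp]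
  simp only [key]
  set B : Fin (m + 1) → A := fun j => T ((F.equivFinOfCardEq hm).symm j)
  have h := hg (m + 1) (by omega) (rowMatrix B)
  rw [rowMatrix_map _ Subtype.val rfl] at h
  rw [← norm_matrixOperator_rowMatrix_le_iff (fun j => (B j).1) hC, ← h,
    ContinuousMap.norm_le _ hC]
  refine forall_congr' fun x => ?_
  have hx : matrixFunction ((rowMatrix B).map g) x =
      Matrix.toEuclideanCLM (n := Fin (m + 1)) (𝕜 := ℂ) (rowMatrix fun j => g (B j) x) := by
    change Matrix.toEuclideanCLM (n := Fin (m + 1)) (𝕜 := ℂ) _ = _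
    rw [rowMatrix_map _ _ (map_zero g), rowMatrix_map _ _ rfl]
  rw [hx, norm_toEuclideanCLM_rowMatrix_le_iff _ hC]
end

/-! ### Word monomials and the numbers `b_n` -/

section
variable {d : ℕ}

/-- The weighted monomial `√b_{n+1} x_{p 0} ⋯ x_{p n}` attached to a word `p` of length `n + 1`. -/
noncomputable def wordMonomial (b : ℕ → ℝ) (i : Σ n, Fin (n + 1) → Fin d) (x : Fin d → ℂ) : ℂ :=
  (√(b (i.1 + 1)) : ℂ) * ∏ l, x (i.2 l)

/-- Indexing by words rather than multi-indices makes this the plain expansion of a power of a sum,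
with no multinomial coefficients. -/
theorem sum_wordMonomial_mul_conj {b : ℕ → ℝ} (hb : ∀ n, 0 ≤ b (n + 1)) (x y : Fin d → ℂ) (n : ℕ) :
    ∑ p, wordMonomial b ⟨n, p⟩ x * conj (wordMonomial b ⟨n, p⟩ y) =
      b (n + 1) * (∑ j, x j * conj (y j)) ^ (n + 1) := by
  rw [Fintype.sum_pow, Finset.mul_sum]
  refine Finset.sum_congr rfl fun p _ => ?_
  have h : (√(b (n + 1)) : ℂ) * √(b (n + 1)) = b (n + 1) := by
    exact_mod_cast Real.mul_self_sqrt (hb n)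
  simp only [wordMonomial, map_mul, map_prod, Complex.conj_ofReal, Finset.prod_mul_distrib]
  rw [← h]
  ring

theorem sum_norm_wordMonomial_sq {b : ℕ → ℝ} (hb : ∀ n, 0 ≤ b (n + 1)) (x : Fin d → ℂ) (n : ℕ) :
    ∑ p, ‖wordMonomial b ⟨n, p⟩ x‖ ^ 2 = b (n + 1) * (∑ j, ‖x j‖ ^ 2) ^ (n + 1) := by
  have h := sum_wordMonomial_mul_conj hb x x n
  simp only [Complex.mul_conj'] at h
  exact_mod_cast h

theorem summable_norm_wordMonomial_sq {b : ℕ → ℝ} (hb : ∀ n, 0 ≤ b (n + 1)) {x : Fin d → ℂ} :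
    (Summable fun i => ‖wordMonomial b i x‖ ^ 2) ↔
      Summable fun n => b (n + 1) * (∑ j, ‖x j‖ ^ 2) ^ (n + 1) := by
  rw [summable_sigma_of_nonneg fun i => sq_nonneg _]
  simp only [tsum_fintype, sum_norm_wordMonomial_sq hb]
  exact ⟨fun h => h.2, fun h => ⟨fun n => (hasSum_fintype _).summable, h⟩⟩

/-- Any bound improves itself: it forces `∑ b_n ‖x‖^{2n}` to converge, hence `‖x‖ ≤ 1`, and then
each term is at most `b_n`. -/
theorem sum_norm_wordMonomial_sq_le_tsum {b : ℕ → ℝ} (hb : ∀ n, 0 ≤ b (n + 1))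
    (hbs : Summable fun n => b (n + 1))
    (hbL : ∀ L : ℝ, (Summable fun n => b (n + 1) * L ^ (n + 1)) → L ≤ 1) {x : Fin d → ℂ} {C : ℝ}
    (hx : ∀ F, ∑ i ∈ F, ‖wordMonomial b i x‖ ^ 2 ≤ C)
    (F : Finset (Σ n, Fin (n + 1) → Fin d)) :
    ∑ i ∈ F, ‖wordMonomial b i x‖ ^ 2 ≤ ∑' n, b (n + 1) := by
  have hsum : Summable fun i => ‖wordMonomial b i x‖ ^ 2 :=
    summable_of_sum_le (fun i => sq_nonneg _) hx
  have hsum' := (summable_norm_wordMonomial_sq hb).1 hsum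
  calc ∑ i ∈ F, ‖wordMonomial b i x‖ ^ 2 ≤ ∑' i, ‖wordMonomial b i x‖ ^ 2 :=
        hsum.sum_le_tsum F fun i _ => sq_nonneg _
    _ = ∑' n, b (n + 1) * (∑ j, ‖x j‖ ^ 2) ^ (n + 1) := by
        rw [hsum.tsum_sigma]
        simp only [tsum_fintype, sum_norm_wordMonomial_sq hb]
    _ ≤ ∑' n, b (n + 1) := hsum'.tsum_le_tsum (fun n => mul_le_of_le_one_right (hb n)
        (pow_le_one₀ (by positivity) (hbL _ hsum'))) hbs

theorem cinner_eq_sum (z w : UnitBall d) : cinner z w = ∑ j, z.1 j * conj (w.1 j) := by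
  simp [cinner, PiLp.inner_apply]

/-- Turns identities for the kernel into power series identities on the whole unit disc. -/
theorem exists_cinner_eq (hd : 1 ≤ d) {ζ : ℂ} (hζ : ‖ζ‖ < 1) :
    ∃ z w : UnitBall d, cinner z w = ζ := by
  obtain ⟨ρ, h1, h2⟩ := exists_between hζ
  have hρ : 0 < ρ := (norm_nonneg ζ).trans_lt h1
  let j : Fin d := ⟨0, hd⟩
  refine ⟨⟨EuclideanSpace.single j (ζ / ρ), ?_⟩, ⟨EuclideanSpace.single j (ρ : ℂ), ?_⟩, ?_⟩
  · rw [mem_ball_zero_iff, PiLp.norm_single, norm_div, Complex.norm_real,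
      Real.norm_of_nonneg hρ.le, div_lt_one hρ]
    exact h1
  · rw [mem_ball_zero_iff, PiLp.norm_single, Complex.norm_real,
      Real.norm_of_nonneg hρ.le]
    exact h2
  · have : (ρ : ℂ) ≠ 0 := by exact_mod_cast hρ.ne'
    simp only [cinner, EuclideanSpace.inner_single_left, PiLp.single_apply, if_true,
      Complex.conj_ofReal]
    field_simp

theorem hasSum_wordMonomial {k : UnitBall d → UnitBall d → ℂ} {b : ℕ → ℝ} (hb : IsNPCoeff k b)
    (z w : UnitBall d) :
    HasSum (fun i => wordMonomial b i z.1 * conj (wordMonomial b i w.1)) (1 - 1 / k z w) := by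
  have hdiag : ∀ z : UnitBall d, Summable fun i => ‖wordMonomial b i z.1‖ ^ 2 := fun z => by
    rw [summable_norm_wordMonomial_sq hb.nonneg]
    have h := (Complex.hasSum_re (hb.hasSum z z)).summable
    refine h.congr fun n => ?_
    have h1 : cinner z z = ((∑ j, ‖z.1 j‖ ^ 2 : ℝ) : ℂ) := by
      rw [cinner_eq_sum]
      push_cast
      exact Finset.sum_congr rfl fun j _ => RCLike.mul_conj _
    rw [h1, ← Complex.ofReal_pow, ← Complex.ofReal_mul, Complex.ofReal_re]
  refine HasSum.sigma_of_hasSum (hb.hasSum z w) (fun n => ?_) ?_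
  · rw [cinner_eq_sum, ← sum_wordMonomial_mul_conj hb.nonneg]
    exact hasSum_fintype _
  -- Regrouping by word length needs absolute summability, which follows from the two diagonal
  -- cases.
  · refine Summable.of_norm_bounded ((hdiag z).add (hdiag w)) fun i => ?_
    rw [norm_mul, RCLike.norm_conj]
    nlinarith [sq_nonneg (‖wordMonomial b i z.1‖ - ‖wordMonomial b i w.1‖),
      sq_nonneg ‖wordMonomial b i z.1‖, sq_nonneg ‖wordMonomial b i w.1‖]

/-- The coefficients of a regular unitarily invariant, non-maximal, complete Nevanlinna–Pick
kernel: `b₁ > 0`, `∑ bₙ < 1`, and `∑ bₙ tⁿ` converges at no `t > 1`. -/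
theorem NPSpace.IsNPCoeff.coeff_properties (hd : 1 ≤ d) {k : UnitBall d → UnitBall d → ℂ} {b : ℕ → ℝ}
    (hreg : IsRegularUnitarilyInvariant k) (hb : IsNPCoeff k b) (hmax : ¬ IsMaximalKernel k) :
    0 < b 1 ∧ (Summable fun n => b (n + 1)) ∧ ∑' n, b (n + 1) < 1 ∧
      ∀ L : ℝ, (Summable fun n => b (n + 1) * L ^ (n + 1)) → L ≤ 1 := by
  obtain ⟨a, ha, hlim, hk⟩ := hreg.exists_coeff
  -- The unconstrained value `b 0` is replaced by `0`, so that full convolutions make sense.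
  let B : ℕ → ℝ := fun n => if n = 0 then 0 else b n
  have hB : ∀ n, 0 ≤ B n := fun n => by
    cases n with
    | zero => simp [B]
    | succ n => simpa [B] using hb.nonneg n
  have hdisc : ∀ ζ : ℂ, ‖ζ‖ < 1 → ∃ κ : ℂ, κ ≠ 0 ∧ HasSum (fun n => (a n : ℂ) * ζ ^ n) κ ∧
      HasSum (fun n => (B n : ℂ) * ζ ^ n) (1 - 1 / κ) := fun ζ hζ => by
    obtain ⟨z, w, rfl⟩ := exists_cinner_eq hd hζ
    refine ⟨k z w, hb.ne_zero z w, hk z w, ?_⟩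
    rw [← hasSum_nat_add_iff' 1]
    simpa [B] using hb.hasSum z w
  have hrec := coeff_recurrence hdisc
  have hle : ∀ N, ∑ n ∈ Finset.range N, B n ≤ 1 := fun N => by
    refine sum_range_le_of_hasSum_le hB (fun t ht0 ht1 => ?_) N
    obtain ⟨κ, -, h1, h2⟩ := hdisc t (by rwa [Complex.norm_real, Real.norm_of_nonneg ht0])
    have h1' := Complex.hasSum_re h1
    have h2' := Complex.hasSum_re h2
    simp only [← Complex.ofReal_pow, ← Complex.ofReal_mul, Complex.ofReal_re] at h1 h1' h2'
    -- On `[0, 1)` the value `κ` is real and non-negative, so `1 - 1/κ ≤ 1`.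
    have hκ : κ = (κ.re : ℂ) := h1.unique (Complex.hasSum_ofReal.2 h1')
    have hκ0 : 0 ≤ κ.re := h1'.nonneg fun n => mul_nonneg (ha n).le (pow_nonneg ht0 n)
    refine ⟨_, ?_, h2'⟩
    rw [hκ, ← Complex.ofReal_one, ← Complex.ofReal_div, ← Complex.ofReal_sub, Complex.ofReal_re]
    have := one_div_nonneg.2 hκ0
    linarith
  have hBs : Summable B := summable_of_sum_range_le hB hle
  have hbs : Summable fun n => b (n + 1) := by
    simpa [B] using (summable_nat_add_iff 1).2 hBs
  have htsum : ∑' n, B n = ∑' n, b (n + 1) := by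
    rw [hBs.tsum_eq_zero_add]
    simp [B]
  have hlt : ∑' n, B n < 1 := by
    refine lt_of_le_of_ne (hBs.tsum_le_of_sum_range_le hle) fun h => hmax ⟨b, hb, ?_⟩
    rw [← h, htsum]
    exact hbs.hasSum
  refine ⟨?_, hbs, htsum ▸ hlt, fun L hL => ?_⟩
  -- The recurrence gives `a_0 = 1` and `a_1 = a_0 b_1`, so `b_1 = a_1 > 0`.
  · have h0 := hrec 0
    have h1 := hrec 1
    have := ha 1
    simp [B, Finset.sum_range_succ] at h0 h1
    rwa [h1, h0, one_mul] at this
  · refine le_one_of_summable ha hB hlim hrec hlt ((summable_nat_add_iff 1).1 ?_)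
    simpa [B] using hL

end

/-! ### Compressions to `H_𝔞` -/

section
variable {X : Type*} {H : Type*} [NormedAddCommGroup H] [InnerProductSpace ℂ H]
  [RKHS ℂ H X ℂ]

theorem NPSpace.IsMulOperator.unique {ψ : X → ℂ} {S T : H →L[ℂ] H} (hS : IsMulOperator ψ S)
    (hT : IsMulOperator ψ T) : S = T :=
  ContinuousLinearMap.ext fun f => RKHS.ext fun z => by rw [hS, hT]

theorem NPSpace.IsMulOperator.smul {ψ : X → ℂ} {T : H →L[ℂ] H} (hT : IsMulOperator ψ T) (c : ℂ) :
    IsMulOperator (fun z => c * ψ z) (c • T) := fun f z => by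
  change (c • T f) z = _
  rw [RKHS.coe_smul, Pi.smul_apply, hT, smul_eq_mul, mul_assoc]

variable (𝔞 : Ideal (multiplierAlgebra H))

theorem inclusion_inner_eq_zero (y : QuotientSpace 𝔞) {u : H} (hu : u ∈ idealRange 𝔞) :
    inner ℂ (inclusion 𝔞 y) u = 0 :=
  Submodule.inner_left_of_mem_orthogonal hu (show inclusion 𝔞 y ∈ (idealRange 𝔞)ᗮ from y.2)

theorem norm_inclusion (y : QuotientSpace 𝔞) : ‖inclusion 𝔞 y‖ = ‖y‖ := rfl

variable [CompleteSpace H]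

theorem inner_projection_right (y : QuotientSpace 𝔞) (u : H) :
    inner ℂ y (projection 𝔞 u) = inner ℂ (inclusion 𝔞 y) u := by
  have h := inclusion_inner_eq_zero 𝔞 y (sub_projection_mem 𝔞 u)
  rw [inner_sub_right, sub_eq_zero] at h
  exact h.symm

/-- The space `H_𝔞` is coinvariant, so adjoints of compressions are restrictions of adjoints. -/
theorem norm_adjoint_functionalCalculus (T : multiplierAlgebra H) (y : QuotientSpace 𝔞) :
    ‖(functionalCalculus 𝔞 T).adjoint y‖ = ‖T.1.adjoint (inclusion 𝔞 y)‖ := by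
  have hmem : T.1.adjoint (inclusion 𝔞 y) ∈ (idealRange 𝔞)ᗮ := by
    rw [Submodule.mem_orthogonal']
    intro u hu
    rw [ContinuousLinearMap.adjoint_inner_left]
    exact inclusion_inner_eq_zero 𝔞 y (idealRange_invariant 𝔞 T hu)
  let x : QuotientSpace 𝔞 := ⟨_, hmem⟩
  have hx : (functionalCalculus 𝔞 T).adjoint y = x := by
    refine ext_inner_right ℂ fun v => ?_
    rw [ContinuousLinearMap.adjoint_inner_left]
    change inner ℂ y (projection 𝔞 (T.1 (inclusion 𝔞 v))) = _
    rw [inner_projection_right, ← ContinuousLinearMap.adjoint_inner_left]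
    rfl
  rw [hx]
  rfl

/-- Evaluation at `o` is a linear functional, so it cannot be injective in dimension above one. -/
theorem exists_ne_zero_apply_eq_zero (hdim : 1 < Module.rank ℂ (QuotientSpace 𝔞)) (o : X) :
    ∃ y : QuotientSpace 𝔞, y ≠ 0 ∧ (inclusion 𝔞 y) o = 0 := by
  let ev : QuotientSpace 𝔞 →ₗ[ℂ] ℂ :=
    (innerSL ℂ (kernelFunction H o) ∘L inclusion 𝔞).toLinearMap
  have hev : ∀ y, ev y = (inclusion 𝔞 y) o := fun y => inner_kernelFunction_left o _
  by_contra! h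
  have hinj : Function.Injective ev := by
    rw [injective_iff_map_eq_zero]
    intro y hy
    by_contra hy0
    exact h y hy0 (by rw [← hev, hy])
  have := LinearMap.lift_rank_le_of_injective ev hinj
  rw [Module.rank_self, Cardinal.lift_one, Cardinal.lift_le_one_iff] at this
  exact this.not_gt hdim
end

/-! ### Coordinate multipliers -/

section
variable {d : ℕ} {H : Type*} [NormedAddCommGroup H] [InnerProductSpace ℂ H] [CompleteSpace H]
  [RKHS ℂ H (UnitBall d) ℂ]

/-- The functional calculus, from `𝓐(H)` to `𝓐_𝔞`. -/
noncomputable def polynomialCalculus (𝔞 : Ideal (multiplierAlgebra H)) :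
    polynomialAlgebra H →ₐ[ℂ] quotientAlgebra 𝔞 :=
  ((functionalCalculus 𝔞).comp (polynomialAlgebra H).val).codRestrict _ fun T =>
    Subalgebra.le_topologicalClosure _ ⟨T.1, T.2, rfl⟩

/-- If multiplication by the words exists and `b₁ ≠ 0`, then it is given by the corresponding
products of the coordinate multipliers. -/
theorem exists_coordinate_multipliers {b : ℕ → ℝ} (hb1 : 0 < b 1)
    {M : (Σ n, Fin (n + 1) → Fin d) → H →L[ℂ] H}
    (hM : ∀ i, IsMulOperator (fun z : UnitBall d => wordMonomial b i z.1) (M i)) :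
    ∃ (Z : Fin d → polynomialAlgebra H) (P : (Σ n, Fin (n + 1) → Fin d) → polynomialAlgebra H),
      (∀ i, (P i).1.1 = M i) ∧
      ∀ i, P i = (√(b (i.1 + 1)) : ℂ) • (List.ofFn fun l => Z (i.2 l)).prod := by
  have hs : (√(b 1) : ℂ) ≠ 0 := by exact_mod_cast (Real.sqrt_pos.2 hb1).ne'
  -- The one-letter word carries the multiplier `√b_1 z_j`; dividing by `√b_1` shows that `z_j`
  -- itself is a multiplier.
  let S : Fin d → H →L[ℂ] H := fun j => (√(b 1) : ℂ)⁻¹ • M ⟨0, fun _ => j⟩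
  have hS : ∀ j, IsMulOperator (fun z : UnitBall d => z.1 j) (S j) := fun j => by
    have := (hM ⟨0, fun _ => j⟩).smul (√(b 1) : ℂ)⁻¹
    convert this using 2 with z
    simp [wordMonomial, hs]
  let Z : Fin d → polynomialAlgebra H := fun j =>
    ⟨⟨S j, _, hS j⟩, Subalgebra.le_topologicalClosure _ ⟨MvPolynomial.X j, by simpa using hS j⟩⟩
  let P : (Σ n, Fin (n + 1) → Fin d) → polynomialAlgebra H := fun i =>
    (√(b (i.1 + 1)) : ℂ) • (List.ofFn fun l => Z (i.2 l)).prod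
  refine ⟨Z, P, fun i => ?_, fun i => rfl⟩
  refine IsMulOperator.unique (ψ := fun z : UnitBall d => wordMonomial b i z.1) ?_ (hM i)
  have hprod : ∀ l : List (Fin d), IsMulOperator
      (fun z : UnitBall d => (l.map fun j => z.1 j).prod) (l.map Z).prod.1.1 := fun l => by
    induction l with
    | nil => intro f z; simp
    | cons j l ih =>
      intro f z
      simp only [List.prod_cons, List.map_cons]
      change S j ((l.map Z).prod.1.1 f) z = _
      rw [hS, ih, mul_assoc]
  have := (hprod (List.ofFn i.2)).smul (√(b (i.1 + 1)) : ℂ)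
  simp only [List.map_ofFn, List.prod_ofFn, Function.comp_def] at this
  exact this

end

/-! ### The norm gap between operators and characters -/

theorem theoremT {d : ℕ} (hd : 1 ≤ d) {H : Type*} [NormedAddCommGroup H]
    [InnerProductSpace ℂ H] [CompleteSpace H] [RKHS ℂ H (UnitBall d) ℂ]
    (hreg : IsRegularUnitarilyInvariant (reproducingKernel H))
    (hNP : IsCompleteNevanlinnaPick (reproducingKernel H))
    (hmax : ¬ IsMaximalKernel (reproducingKernel H))
    (𝔞 : Ideal (multiplierAlgebra H)) (hclosed : IsWeakStarClosed 𝔞) (hproper : 𝔞 ≠ ⊤)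
    (hdim : 1 < Module.rank ℂ (QuotientSpace 𝔞)) :
    ¬ IsCompletelyIsometric
      (WeakDual.gelfandTransform ℂ (quotientAlgebra 𝔞)).toLinearMap := by
  intro hci
  obtain ⟨b, hb⟩ := hNP
  obtain ⟨hb1, hbs, hblt, hbL⟩ := hb.coeff_properties hd hreg hmax
  let o : UnitBall d := ⟨0, by simp⟩
  obtain ⟨M, hM, hMsum⟩ := exists_row_of_kernel_factor (H := H)
    (fun (i : Σ n, Fin (n + 1) → Fin d) (z : UnitBall d) => wordMonomial b i z.1) o
    (fun z => by rw [← reproducingKernel_conj_symm, hreg.normalized o z rfl, map_one])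
    (fun z w => by
      have h := (hasSum_wordMonomial hb z w).mul_right (reproducingKernel H z w)
      rwa [sub_mul, one_mul, one_div, inv_mul_cancel₀ (hb.ne_zero z w)] at h)
  obtain ⟨Z, P, hPM, hPZ⟩ := exists_coordinate_multipliers hb1 hM
  let T : (Σ n, Fin (n + 1) → Fin d) → quotientAlgebra 𝔞 := fun i => polynomialCalculus 𝔞 (P i)
  have hTadj : ∀ i y, ‖(T i).1.adjoint y‖ = ‖(M i).adjoint (inclusion 𝔞 y)‖ := fun i y => by
    rw [← hPM]
    exact norm_adjoint_functionalCalculus 𝔞 (P i).1 y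
  have hchar : ∀ (χ : WeakDual.characterSpace ℂ (quotientAlgebra 𝔞)) i,
      (WeakDual.gelfandTransform ℂ (quotientAlgebra 𝔞)).toLinearMap (T i) χ =
        wordMonomial b i fun j => χ (polynomialCalculus 𝔞 (Z j)) := fun χ i => by
    change WeakDual.CharacterSpace.toAlgHom χ (polynomialCalculus 𝔞 (P i)) = _
    rw [hPZ, map_smul, map_smul, map_list_prod, map_list_prod, List.map_ofFn, List.map_ofFn,
      List.prod_ofFn]
    rfl
  have hupper : ∀ (F : Finset (Σ n, Fin (n + 1) → Fin d)) (y : QuotientSpace 𝔞),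
      ∑ i ∈ F, ‖(T i).1.adjoint y‖ ^ 2 ≤ 1 ^ 2 * ‖y‖ ^ 2 := fun F y => by
    simp only [hTadj]
    have h := sum_le_hasSum F (fun i _ => sq_nonneg _) (hMsum (inclusion 𝔞 y))
    rw [norm_inclusion] at h
    have := sq_nonneg ‖(inclusion 𝔞 y) o‖
    linarith
  set β := ∑' n, b (n + 1)
  have hβ0 : 0 ≤ β := tsum_nonneg hb.nonneg
  have hcharle : ∀ (F : Finset (Σ n, Fin (n + 1) → Fin d))
      (χ : WeakDual.characterSpace ℂ (quotientAlgebra 𝔞)),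
      ∑ i ∈ F, ‖(WeakDual.gelfandTransform ℂ (quotientAlgebra 𝔞)).toLinearMap (T i) χ‖ ^ 2 ≤
        √β ^ 2 := fun F χ => by
    simp only [hchar, Real.sq_sqrt hβ0]
    refine sum_norm_wordMonomial_sq_le_tsum hb.nonneg hbs hbL (C := 1 ^ 2) (fun F => ?_) F
    -- First use of complete isometry: contractivity of the operator rows passes to the characters
    -- and supplies the crude bound `1`.
    simpa only [hchar] using (hci.sum_sq_le_iff F T zero_le_one).2 (hupper F) χ
  obtain ⟨y, hy0, hyo⟩ := exists_ne_zero_apply_eq_zero 𝔞 hdim o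
  have hy := hMsum (inclusion 𝔞 y)
  rw [hyo, norm_inclusion, norm_zero, zero_pow two_ne_zero, sub_zero] at hy
  have hle : ‖y‖ ^ 2 ≤ β * ‖y‖ ^ 2 := by
    refine hasSum_le_of_sum_le hy fun F => ?_
    -- Second use, in the other direction: the improved scalar bound `√β` passes back to the
    -- operators.
    have h := (hci.sum_sq_le_iff F T (Real.sqrt_nonneg β)).1 (hcharle F) y
    simpa only [hTadj, Real.sq_sqrt hβ0] using h
  have hpos : 0 < ‖y‖ ^ 2 := pow_pos (norm_pos_iff.2 hy0) 2
  nlinarith
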